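/- For $n\ge 1$ let $f(n)$ be the least integer $k$ such that every bounded set $A\subset\mathbb R^n$ with at least two points can be partitioned into at most $k$ sets, each of diameter strictly smaller than the diameter of $A$ (Euclidean distance). Then $f(321)\ge 333$. Moreover $f(n)>n+1$ for every $n\ge 321$, so Borsuk's conjecture that $f(n)=n+1$ fails in every dimension $n\ge 321$. -/

import Mathlib

/-- The set `A` can be partitioned into at most `k` sets of smaller diameter.
Parts are allowed to be empty, which is what "at most `k`" means; for bounded `A` all the diameters
are finite, so that `Metric.diam` is the usual diameter. -/
def SplitsIntoSmaller {E : Type*} [PseudoMetricSpace E] (A : Set E) (k : ℕ) : Prop :=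
  ∃ P : Fin k → Set E,
    (∀ i j, i ≠ j → Disjoint (P i) (P j)) ∧
    (⋃ i, P i) = A ∧
    ∀ i, Metric.diam (P i) < Metric.diam A

/-- The Borsuk number `f(n)`: the least `k` such that every bounded set with at least two points in
Euclidean `n`-space can be partitioned into at most `k` sets of smaller diameter. (Sets with at most
one point have diameter `0`, so no set has a smaller diameter.)
If there were no such `k`, the value would be `0`, so a positive value is always a true minimum. -/
noncomputable def borsukNumber (n : ℕ) : ℕ :=
  sInf {k : ℕ | ∀ A : Set (EuclideanSpace ℝ (Fin n)),
    Bornology.IsBounded A → A.Nontrivial → SplitsIntoSmaller A k}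

/-! The `G₂(4)` graph, strongly regular with parameters `(416, 100, 36, 20)` and of clique number
`5`, gives `416` points in `ℝ⁶⁵` at two distances. A part of smaller diameter is a clique, so at
least `84` parts are needed; adding the vertices of a simplex handles larger dimensions. The
functions below that are applied to bit masks are written with recursors and the basic operations on
`ℕ`, which the kernel evaluates efficiently. -/

/-! The eigenvalue 20 of the `G₂(4)` graph has multiplicity 65. Projecting the standard basis onto
its eigenspace gives 416 points in ℝ⁶⁵ with squared distance 1/4 between adjacent and 1/3 between
non-adjacent vertices (`g24Proj_apply`, `g24Proj_mul_self`). A part of smaller diameter is therefore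
a clique, hence has at most 5 points (`g24_cliqueFree`). For n > 65 the remaining n - 65 dimensions
carry n - 65 simplex points at distance 1/√3 from each other and from all 416 points
(`exists_simplex`); each needs a part of its own. So at least 84 + (n - 65) = n + 19 parts are
needed, which is 340 for n = 321.

The graph facts are finite computations. Translation by multiples of 32 modulo 416 is an
automorphism, so only the 32 orbit representatives are tested. -/

/-- The adjacency rows of the vertices `0, …, 31` of the `G₂(4)` graph, as bit masks. -/
def g24Seed : ℕ :=
  [0x8048211911484a4c18a4028a1914049a0a1805119028043100240a181150891809500850118000691a2944ac101411100000000,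
    0x9260b512010834110204042101040624112282a84b50032800c0086100a601406214448060846830208162400431218613320000,
    0x5202580ace613158408804110040810930045024900c8828c82a62400019a01480a2080a5a0128c0104810898040828001552000,
    0xc160494012498045100240c020152824c88e18180009218010280006d000880a006272050e1c94118241229450002024c8c09000,
    0x8024214c004028913400ca8060c3000918204500032a40c8040980408a008921400b00348190e40102400626325403ee21b000,
    0x9860268003441800230001200a02c4040116a80c254008300c42306112021464301350a01004403222884113342963034860000,
    0x20014180011200832805281410081980c42a0022019606062420d1110a00321104000421c820a298c150c00ce2c048281da32000,
    0x1500006a0c0180c452331544a04440344004111202022110c949528a1084022902aa240e800c01800a228610d030a4012110000,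
    0x8020300048d002008d600842a8830238306221c21a0f00900000a026044800d352454224142804c54232408c6024a04641000,
    0xc5481a402c2130a84600940628194980140c44024014824132300d20c35252209080012002c250008044600242c01210842a000,
    0x250940303200022108c486281d3601620248030000944c802295044024481b00108282a203550506140019030228001203949000,
    0x528b10c00418048021800806720170140c0034096e284012d250a61424c250283e94116880480a40100291800018000cc0000000,
    0x8408003042000c055000d018843008284b880c40101960c0a0000000688c280c58026a4026491180149202862250080636c28518,
    0x4800600ac260218a11622246324091a80142326400060824422211984020283040800828402060c000346006e220601248210254,
    0xa63120512ca322521810a1a2814a100a900409800028004501029e00051302a44a00089100c01109e42000304984a44c60000000,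
    0x814a40241603086188a500d8011184800948000c100148c0806501054c1e02030844a314008c5500840101092028020398401618,
    0x180000830848800a91661514040d012108044205001c86008c6293180088012180418a09d80480c00048c00c81a24c40271020d4,
    0x2e1501b000801891000000000430148cc120c812c25162054c00205108a4214ac1004500210920893800c240a048882415a01262,
    0xc4300002823000091860a80608903124a9203924484b0018524640101400c0331048a1b618452104801210046022108900524,
    0x90028e00208d00241c029a090a4802801651949480c0000c6651580cdac494580449414010000105001d080a98049d0000000000,
    0xa2c0181210883140c0000409410409031000c20503180c8037931462a0880030218294097a0440301400086100a2428007050486,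
    0x4b11a612004060a1080422408064018c412223220941a24c400049800262004324a615302101a2b0480460240000400a84022152,
    0x14c611640245014c40045d000009801800280d0010098822902e0022080ca600082c6014020126000c61228c5a50828a8200930c,
    0x25114140320010831000c01280302c05471b1812929404a201880440310011090000022109048c05521a4280e650083020061468,
    0x320140a10900005120a604214d160330208440a100944300a430004300a2b3128110c403c20128911100004380a084a800130446,
    0x14c03470208000284354150c100448221228014040182e0000960822228c150010082a807200002200c0b60c0532480670511492,
    0x2a8002920450d500ac00101804280940c800ce00051b00c02c000b00088808c0250315002c0802806c00c81422c2560028331170,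
    0x484180846203002c9500cc2040db008c4a92400403019400200903cc019818010804800c28c440a1014014242322214404a258,
    0x8048002801961c05021d001412001c8050880028c0500a0900c49105121c4006d2002c40608970188090840923490806020290e2,
    0x3c82b2702c024022163211928430081202901c800518144080000a804100010548002a094d000940628844802592444006815030,
    0x40c0604924a04140331120c630027022a808b018c02a28145202082214a210e801100a800250108500003014c020280c8a006818,
    0x418b20451800c049810108c01103008508180089a1419814d08e00244c02404920a4511184118211080020851018d00a40608818].foldr
    (fun r acc => acc * 2 ^ 416 + r) 0

/-- The adjacency row of the vertex `v` of the `G₂(4)` graph as a bit mask: the row of `v % 32`,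
rotated cyclically by `32 * (v / 32)` places. -/
def g24Row (v : ℕ) : ℕ :=
  Nat.mod (Nat.shiftRight
    (Nat.mul (Nat.succ (Nat.pow 2 416))
      (Nat.mod (Nat.shiftRight g24Seed (Nat.mul 416 (Nat.mod v 32))) (Nat.pow 2 416)))
    (Nat.sub 416 (Nat.mul 32 (Nat.div v 32)))) (Nat.pow 2 416)

/-! ### Routines on bit masks -/

/-- Test `p` at all numbers below `n`. -/
noncomputable def allBelow (p : ℕ → Bool) (n : ℕ) : Bool :=
  Nat.rec true (fun i ih => Bool.rec false ih (p i)) n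

/-- The binary digit of `n` at place `i`. -/
def bitAt (n i : ℕ) : Bool := Nat.beq (Nat.mod (Nat.shiftRight n i) 2) 1

/-- The number whose base `1024` digits are the lowest `k` binary digits of `n`. -/
noncomputable def spreadBits (n k : ℕ) : ℕ :=
  Nat.rec 0 (fun i ih => Bool.rec ih (Nat.add ih (Nat.pow 1024 i)) (bitAt n i)) k

/-- A lookup table of the discrete logarithms to base `2` modulo `419`. -/
noncomputable def logTable : ℕ :=
  Nat.rec 0 (fun k ih => Nat.add ih (Nat.shiftLeft k (Nat.mul 9 (Nat.mod (Nat.pow 2 k) 419)))) 418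

/-- The place of the lowest binary digit `1` of a number whose lowest such place is below `418`. -/
noncomputable def lowestBit (n : ℕ) : ℕ :=
  -- The gcd isolates the lowest set bit as a power of 2. Since 2 is a primitive root modulo 419,
  -- its residue determines the exponent below 418, stored in a 9-bit slot.
  Nat.mod (Nat.shiftRight logTable (Nat.mul 9 (Nat.mod (Nat.gcd n (Nat.pow 2 418)) 419))) 512

/-- Run through the set bits `i ≥ j` of `m`, lowest first, and test `P i`. The result is `false`
if `lowestBit` ever skips a set bit or if there are more than `fuel` set bits. -/
noncomputable def forallBits (P : ℕ → Bool) (m fuel : ℕ) : ℕ → Bool :=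
  Nat.rec (fun _ => false) (fun _ ih j =>
    Nat.rec true (fun _ _ =>
      -- Recursion on a successor acts as a strict `let` for the index `i`.
      Nat.rec (motive := fun _ => Bool) false (fun i _ =>
        Bool.rec false (Bool.rec false (ih (Nat.succ i)) (P i))
          (Nat.beq (Nat.mod m (Nat.pow 2 i)) (Nat.mod m (Nat.pow 2 j))))
        (Nat.succ (Nat.add j (lowestBit (Nat.shiftRight m j)))))
      (Nat.shiftRight m j)) fuel

/-- Test that the bits of `m` at places `≥ j` contain no clique of size `d`. -/
noncomputable def cliqueFreeAbove (row : ℕ → ℕ) (fuel d : ℕ) : ℕ → ℕ → Bool :=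
  Nat.rec (fun _ _ => false)
    (fun _ ih m j => forallBits (fun i => ih (Nat.land m (row i)) (Nat.succ i)) m fuel j) d

/-- The mask of the `j < 416` with `j % 32 ≤ b`. -/
def residueMask (b : ℕ) : ℕ :=
  Nat.mul (Nat.pred (Nat.pow 2 (Nat.succ b)))
    (Nat.div (Nat.pred (Nat.pow 2 416)) (Nat.pred (Nat.pow 2 32)))

/-! ### Soundness of the routines -/

theorem allBelow_spec {p : ℕ → Bool} {n : ℕ} (h : allBelow p n = true) {i : ℕ} (hi : i < n) :
    p i = true := by
  induction n with
  | zero => omega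
  | succ n ih =>
    change Bool.rec false (allBelow p n) (p n) = true at h
    cases hp : p n with
    | false => rw [hp] at h; cases h
    | true =>
      rw [hp] at h
      rcases Nat.lt_succ_iff_lt_or_eq.1 hi with hi | rfl
      · exact ih h hi
      · exact hp

theorem bitAt_eq_testBit (n i : ℕ) : bitAt n i = n.testBit i := by
  rw [Nat.testBit_eq_decide_div_mod_eq, ← Nat.shiftRight_eq_div_pow, Bool.eq_iff_iff,
    decide_eq_true_iff]
  change Nat.beq (n >>> i % 2) 1 = true ↔ _
  rw [Nat.beq_eq]

theorem spreadBits_succ (n k : ℕ) :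
    spreadBits n (k + 1) = 2 ^ (10 * k) * (n.testBit k).toNat + spreadBits n k := by
  change Bool.rec (motive := fun _ => ℕ) (spreadBits n k) (spreadBits n k + 1024 ^ k)
    (bitAt n k) = _
  rw [bitAt_eq_testBit, pow_mul]
  cases n.testBit k <;> norm_num [add_comm]

theorem spreadBits_lt (n k : ℕ) : spreadBits n k < 2 ^ (10 * k) := by
  induction k with
  | zero => exact Nat.one_pos
  | succ k ih =>
    rw [spreadBits_succ]
    have h1 := Bool.toNat_le (n.testBit k)
    have h2 : 2 ^ (10 * (k + 1)) = 1024 * 2 ^ (10 * k) := by rw [mul_add, pow_add]; ring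
    rw [h2]
    nlinarith

theorem land_two_pow_mul_add {i b b' : ℕ} (a a' : ℕ) (hb : b < 2 ^ i) (hb' : b' < 2 ^ i) :
    (2 ^ i * a + b) &&& (2 ^ i * a' + b') = 2 ^ i * (a &&& a') + (b &&& b') := by
  refine Nat.eq_of_testBit_eq fun j => ?_
  rw [Nat.testBit_and, Nat.testBit_two_pow_mul_add _ hb, Nat.testBit_two_pow_mul_add _ hb',
    Nat.testBit_two_pow_mul_add _ (Nat.and_lt_two_pow _ hb')]
  split <;> simp [Nat.testBit_and]

theorem land_spreadBits (m n k : ℕ) :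
    spreadBits m k &&& spreadBits n k = spreadBits (m &&& n) k := by
  induction k with
  | zero => exact Nat.and_self 0
  | succ k ih =>
    rw [spreadBits_succ, spreadBits_succ, spreadBits_succ,
      land_two_pow_mul_add _ _ (spreadBits_lt m k) (spreadBits_lt n k), ih, Nat.testBit_and]
    cases m.testBit k <;> cases n.testBit k <;> rfl

/-- Casting out: 1024 ≡ 1 modulo 1023, so a number is congruent to its base 1024 digit sum. -/
theorem spreadBits_modEq (n k : ℕ) :
    spreadBits n k ≡ ((Finset.range k).filter fun i => n.testBit i = true).card [MOD 1023] := by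
  induction k with
  | zero => rfl
  | succ k ih =>
    rw [spreadBits_succ, Finset.range_add_one, Finset.filter_insert]
    have h : 2 ^ (10 * k) ≡ 1 [MOD 1023] := by
      rw [pow_mul]
      simpa using Nat.ModEq.pow k (show 2 ^ 10 ≡ 1 [MOD 1023] from rfl)
    split_ifs with hk
    · rw [Finset.card_insert_of_notMem (by simp), add_comm _ 1, hk]
      exact (h.mul_right 1).add ih
    · simpa [hk] using ih

theorem land_spreadBits_mod (m n : ℕ) {k : ℕ} (hk : k < 1023) :
    (spreadBits m k &&& spreadBits n k) % 1023 =
      ((Finset.range k).filter fun i => m.testBit i = true ∧ n.testBit i = true).card := by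
  rw [land_spreadBits, spreadBits_modEq, Nat.mod_eq_of_lt]
  · simp
  · exact ((Finset.card_filter_le _ _).trans (Finset.card_range k).le).trans_lt hk

/-- Correctness of `lowestBit` is never needed: the comparison of residues certifies that no set bit
from `j` on is skipped. -/
theorem forallBits_spec {P : ℕ → Bool} {m fuel j : ℕ} (h : forallBits P m fuel j = true) {b : ℕ}
    (hj : j ≤ b) (hb : m.testBit b = true) : P b = true := by
  induction fuel generalizing j with
  | zero => cases h
  | succ fuel ih =>
    change Nat.rec true (fun _ _ => Bool.rec false
        (Bool.rec false (forallBits P m fuel (j + lowestBit (m >>> j) + 1))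
          (P (j + lowestBit (m >>> j))))
        (Nat.beq (m % 2 ^ (j + lowestBit (m >>> j))) (m % 2 ^ j))) (m >>> j) = true at h
    generalize j + lowestBit (m >>> j) = i at h
    have hm : (m >>> j).testBit (b - j) = true := by
      rw [Nat.testBit_shiftRight, Nat.add_sub_cancel' hj, hb]
    generalize m >>> j = x at h hm
    cases x with
    | zero => simp at hm
    | succ x =>
      dsimp only at h
      cases hlow : Nat.beq (m % 2 ^ i) (m % 2 ^ j) with
      | false => rw [hlow] at h; cases h
      | true =>
        rw [hlow] at h
        cases hP : P i with
        | false => rw [hP] at h; cases h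
        | true =>
          rw [hP] at h
          have hlow' := congrArg (fun x => x.testBit b) (Nat.eq_of_beq_eq_true hlow)
          simp only [Nat.testBit_mod_two_pow, hb, Bool.and_true, decide_eq_decide] at hlow'
          rcases (show i ≤ b by omega).eq_or_lt with rfl | hib
          · exact hP
          · exact ih h hib

/-- Induction on the clique size: the least vertex is removed, and the others are later bits of the
mask cut down to its neighbours. -/
theorem cliqueFreeAbove_spec {row : ℕ → ℕ} {fuel d m j : ℕ}
    (h : cliqueFreeAbove row fuel d m j = true) {s : Finset ℕ}
    (hs : ∀ b ∈ s, j ≤ b ∧ m.testBit b = true)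
    (hrow : ∀ x ∈ s, ∀ y ∈ s, x ≠ y → (row x).testBit y = true) : s.card ≠ d := by
  induction d generalizing m j s with
  | zero => cases h
  | succ d ih =>
    intro hd
    have hne : s.Nonempty := Finset.card_pos.1 (by omega)
    have hmin := s.min'_mem hne
    change forallBits (fun i => cliqueFreeAbove row fuel d (m &&& row i) (i + 1)) m fuel j = true
      at h
    have hb := forallBits_spec h (hs _ hmin).1 (hs _ hmin).2
    refine ih hb (s := s.erase (s.min' hne)) (fun x hx => ?_) (fun x hx y hy => ?_) ?_
    · have hx' := Finset.mem_of_mem_erase hx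
      refine ⟨(Finset.min'_lt_of_mem_erase_min' s hne hx), ?_⟩
      exact (Nat.testBit_and _ _ _).trans (by
        rw [(hs x hx').2, hrow _ hmin x hx' (Finset.ne_of_mem_erase hx).symm, Bool.and_true])
    · exact hrow x (Finset.mem_of_mem_erase hx) y (Finset.mem_of_mem_erase hy)
    · rw [Finset.card_erase_of_mem hmin, hd, Nat.add_sub_cancel]

/-! ### Finite checks on the 32 orbit representatives -/

/-- Here `xor x (not y)` is Boolean equality of `x` and `y`. -/
theorem g24_symm_check : allBelow (fun v => allBelow (fun w =>
    Bool.xor (bitAt (g24Row v) w) (Bool.not (bitAt (g24Row w) v))) 416) 32 = true := by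
  decide +kernel

theorem g24_irrefl_check : allBelow (fun v => Bool.not (bitAt (g24Row v) v)) 32 = true := by
  decide +kernel

theorem residueMask_check : allBelow (fun b => allBelow (fun w =>
    Bool.xor (bitAt (residueMask b) w) (Bool.not (Nat.ble (Nat.mod w 32) b))) 416) 32 = true := by
  decide +kernel

theorem g24_commonNeighbors_check : allBelow (fun v => allBelow (fun w =>
    Nat.beq
      (Nat.mod (Nat.land (spreadBits (g24Row v) 416) (spreadBits (g24Row w) 416)) 1023)
      (cond (Nat.beq v w) 100 (cond (bitAt (g24Row v) w) 36 20))) 416) 32 = true := by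
  decide +kernel

/-- Test that the neighbours `w` of `b` with `w % 32 ≤ b` contain no clique of size `5`. -/
noncomputable def g24CliqueTest (b : ℕ) : Bool :=
  cliqueFreeAbove g24Row 416 5 (Nat.land (g24Row b) (residueMask b)) 0

theorem g24CliqueTest_first : allBelow g24CliqueTest 20 = true := by
  decide +kernel

theorem g24CliqueTest_second : allBelow (fun b => g24CliqueTest (Nat.add 20 b)) 5 = true := by
  decide +kernel

theorem g24CliqueTest_third : allBelow (fun b => g24CliqueTest (Nat.add 25 b)) 4 = true := by
  decide +kernel

theorem g24CliqueTest_fourth : allBelow (fun b => g24CliqueTest (Nat.add 29 b)) 3 = true := by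
  decide +kernel

theorem g24CliqueTest_eq_true {b : ℕ} (hb : b < 32) : g24CliqueTest b = true := by
  by_cases h1 : b < 20
  · exact allBelow_spec g24CliqueTest_first h1
  by_cases h2 : b < 25
  · obtain ⟨c, rfl⟩ := Nat.exists_eq_add_of_le (not_lt.1 h1)
    exact allBelow_spec g24CliqueTest_second (by omega)
  by_cases h3 : b < 29
  · obtain ⟨c, rfl⟩ := Nat.exists_eq_add_of_le (not_lt.1 h2)
    exact allBelow_spec g24CliqueTest_third (by omega)
  · obtain ⟨c, rfl⟩ := Nat.exists_eq_add_of_le (not_lt.1 h3)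
    exact allBelow_spec g24CliqueTest_fourth (by omega)

/-! ### Cyclic symmetry, strong regularity and clique number -/

/-- Multiplication by 2^N + 1 writes two copies of `r` side by side; a window of length N in them is
a rotation of `r`. -/
theorem testBit_rotate {N r a w : ℕ} (hr : r < 2 ^ N) (ha : a < N) (hw : w < N) :
    (((2 ^ N + 1) * r) >>> (N - a) % 2 ^ N).testBit w = r.testBit ((w + N - a) % N) := by
  rw [Nat.testBit_mod_two_pow, Nat.testBit_shiftRight, add_mul, one_mul,
    Nat.testBit_two_pow_mul_add _ hr]
  simp only [hw, decide_true, Bool.true_and]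
  split_ifs with h
  · rw [Nat.mod_eq_of_lt (by omega)]
    congr 1
    omega
  · rw [Nat.mod_eq_sub_mod (by omega), Nat.mod_eq_of_lt (by omega)]
    congr 1
    omega

set_option exponentiation.threshold 416 in
theorem g24Row_testBit {v w : ℕ} (hv : v < 416) (hw : w < 416) :
    (g24Row v).testBit w =
      (g24Seed >>> (416 * (v % 32)) % 2 ^ 416).testBit ((w + 416 - 32 * (v / 32)) % 416) :=
  testBit_rotate (N := 416) (a := 32 * (v / 32)) (Nat.mod_lt _ (Nat.two_pow_pos 416)) (by omega) hw

/-- Translation by a multiple of `32` preserves adjacency. -/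
theorem g24Row_testBit_add (v w t : Fin 416) (ht : (t : ℕ) % 32 = 0) :
    (g24Row (v + t : Fin 416)).testBit (w + t : Fin 416) = (g24Row v).testBit w := by
  have hv := v.isLt
  have hw := w.isLt
  have ht' := t.isLt
  rw [g24Row_testBit (Fin.isLt _) (Fin.isLt _), g24Row_testBit hv hw, Fin.val_add, Fin.val_add]
  have h1 : ((v : ℕ) + t) % 416 % 32 = v % 32 := by omega
  have h2 : (((w : ℕ) + t) % 416 + 416 - 32 * (((v : ℕ) + t) % 416 / 32)) % 416 =
      (w + 416 - 32 * (v / 32)) % 416 := by omega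
  rw [h1, h2]

/-- Every vertex has a translate among the first `32`. -/
theorem exists_translate_lt (v : Fin 416) :
    ∃ t : Fin 416, (t : ℕ) % 32 = 0 ∧ ((v + t : Fin 416) : ℕ) < 32 := by
  have hv := v.isLt
  refine ⟨⟨(416 - 32 * (v / 32)) % 416, by omega⟩, ?_, ?_⟩
  · change (416 - 32 * ((v : ℕ) / 32)) % 416 % 32 = 0
    omega
  · rw [Fin.val_add]
    change ((v : ℕ) + (416 - 32 * (v / 32)) % 416) % 416 < 32
    omega

/-- The `G₂(4)` graph. -/
def g24 : SimpleGraph (Fin 416) where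
  Adj v w := (g24Row v).testBit w = true
  symm := ⟨fun v w h => by
    obtain ⟨t, ht, hlt⟩ := exists_translate_lt v
    rw [← g24Row_testBit_add _ _ t ht] at h ⊢
    have := allBelow_spec (allBelow_spec g24_symm_check hlt) (w + t).isLt
    rw [bitAt_eq_testBit, bitAt_eq_testBit, h] at this
    simpa using this⟩
  loopless := ⟨fun v h => by
    obtain ⟨t, ht, hlt⟩ := exists_translate_lt v
    rw [← g24Row_testBit_add _ _ t ht] at h
    have := allBelow_spec g24_irrefl_check hlt
    rw [bitAt_eq_testBit, h] at this
    cases this⟩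

instance : DecidableRel g24.Adj := fun v w =>
  inferInstanceAs (Decidable ((g24Row v).testBit w = true))

theorem g24_adj_add {v w t : Fin 416} (ht : (t : ℕ) % 32 = 0) :
    g24.Adj (v + t) (w + t) ↔ g24.Adj v w := by
  change _ = true ↔ _ = true
  rw [g24Row_testBit_add _ _ _ ht]

theorem card_filter_adj_adj (v w : Fin 416) :
    (Finset.univ.filter fun u => g24.Adj v u ∧ g24.Adj w u).card =
      if v = w then 100 else if g24.Adj v w then 36 else 20 := by
  obtain ⟨t, ht, hlt⟩ := exists_translate_lt v
  have key := Nat.eq_of_beq_eq_true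
    (allBelow_spec (allBelow_spec g24_commonNeighbors_check hlt) (w + t).isLt)
  replace key := (land_spreadBits_mod _ _ (by norm_num)).symm.trans key
  have h1 : (Finset.univ.filter fun u => g24.Adj v u ∧ g24.Adj w u).card =
      ((Finset.range 416).filter fun i => (g24Row (v + t : Fin 416)).testBit i = true ∧
        (g24Row (w + t : Fin 416)).testBit i = true).card := by
    refine Finset.card_bij (fun u _ => ((u + t : Fin 416) : ℕ)) ?_ ?_ ?_
    · intro u hu
      rw [Finset.mem_filter] at hu
      exact Finset.mem_filter.2 ⟨Finset.mem_range.2 (u + t).isLt,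
        (g24_adj_add ht).2 hu.2.1, (g24_adj_add ht).2 hu.2.2⟩
    · intro u _ u' _ h
      exact add_right_cancel (Fin.ext h)
    · intro i hi
      rw [Finset.mem_filter, Finset.mem_range] at hi
      refine ⟨⟨i, hi.1⟩ - t, ?_, by rw [sub_add_cancel]⟩
      rw [Finset.mem_filter, ← g24_adj_add ht, ← g24_adj_add (v := w) ht, sub_add_cancel]
      exact ⟨Finset.mem_univ _, hi.2⟩
  rw [h1, key, bitAt_eq_testBit]
  have h2 : Nat.beq (v + t : Fin 416) (w + t : Fin 416) = decide (v = w) := by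
    rw [Bool.eq_iff_iff, Nat.beq_eq, decide_eq_true_iff, ← Fin.ext_iff, add_left_inj]
  have h3 : (g24Row (v + t : Fin 416)).testBit (w + t : Fin 416) = decide (g24.Adj v w) := by
    rw [g24Row_testBit_add _ _ _ ht, Bool.eq_iff_iff, decide_eq_true_iff]
    rfl
  rw [h2, h3]
  simp only [Bool.cond_decide]

theorem g24_isSRGWith : g24.IsSRGWith 416 100 36 20 where
  card := Fintype.card_fin 416
  regular v := by
    have h := card_filter_adj_adj v v
    rw [if_pos rfl] at h
    rw [← h, ← SimpleGraph.card_neighborFinset_eq_degree]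
    congr 1
    ext u
    simp
  of_adj v w h := by
    have h' := card_filter_adj_adj v w
    rw [if_neg h.ne, if_pos h] at h'
    rw [← h', ← Set.toFinset_card]
    congr 1
    ext u
    simp [SimpleGraph.mem_commonNeighbors]
  of_not_adj v w hne h := by
    have h' := card_filter_adj_adj v w
    rw [if_neg hne, if_neg h] at h'
    rw [← h', ← Set.toFinset_card]
    congr 1
    ext u
    simp [SimpleGraph.mem_commonNeighbors]

/-- In a 6-clique, a vertex of largest residue modulo 32 can be translated to some b < 32. The other
five then form a clique among the neighbours of b with residue at most b, which `g24CliqueTest`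
excludes. -/
theorem g24_cliqueFree : g24.CliqueFree 6 := by
  rintro s ⟨hs, hcard⟩
  obtain ⟨v, hv, hmax⟩ := s.exists_max_image (fun x => (x : ℕ) % 32)
    (Finset.card_pos.1 (by omega))
  obtain ⟨t, ht, hlt⟩ := exists_translate_lt v
  have hmod (x : Fin 416) : ((x + t : Fin 416) : ℕ) % 32 = x % 32 := by
    rw [Fin.val_add]
    omega
  refine cliqueFreeAbove_spec (g24CliqueTest_eq_true hlt)
    (s := (s.erase v).map ⟨fun x => ((x + t : Fin 416) : ℕ),
      fun x y h => add_right_cancel (Fin.ext h)⟩) ?_ ?_ ?_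
  · intro b hb
    obtain ⟨x, hx, rfl⟩ := Finset.mem_map.1 hb
    have hxs := Finset.mem_of_mem_erase hx
    refine ⟨Nat.zero_le _, (Nat.testBit_and _ _ _).trans ?_⟩
    have h1 := (g24_adj_add ht).2 (hs hv hxs (Finset.ne_of_mem_erase hx).symm)
    have h2 := allBelow_spec (allBelow_spec residueMask_check hlt) (x + t).isLt
    have h3 : Nat.ble (((x + t : Fin 416) : ℕ) % 32) (v + t : Fin 416) = true := by
      rw [Nat.ble_eq, hmod, ← Nat.mod_eq_of_lt hlt, hmod]
      exact hmax x hxs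
    rw [bitAt_eq_testBit] at h2
    change Bool.xor _ (!(Nat.ble (((x + t : Fin 416) : ℕ) % 32) _)) = true at h2
    rw [h3] at h2
    rw [Bool.and_eq_true]
    refine ⟨h1, ?_⟩
    change (residueMask (v + t : Fin 416)).testBit (x + t : Fin 416) = true
    simpa using h2
  · intro a ha b hb hab
    obtain ⟨x, hx, rfl⟩ := Finset.mem_map.1 ha
    obtain ⟨y, hy, rfl⟩ := Finset.mem_map.1 hb
    exact (g24_adj_add ht).2 (hs (Finset.mem_of_mem_erase hx) (Finset.mem_of_mem_erase hy)
      fun h => hab (by rw [h]))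
  · rw [Finset.card_map, Finset.card_erase_of_mem hv, hcard]

/-! ### The 416 points in ℝ⁶⁵ -/

/-- A symmetric idempotent real matrix of trace `r` is a Gram matrix of vectors in `ℝʳ`. -/
theorem exists_inner_eq_of_isIdempotentElem {ι : Type*} [Fintype ι] [DecidableEq ι]
    {P : Matrix ι ι ℝ} (hs : P.IsSymm) (hP : P * P = P) {r : ℕ} (hr : P.trace = r) :
    ∃ p : ι → EuclideanSpace ℝ (Fin r), ∀ i j, inner ℝ (p i) (p j) = P i j := by
  have hidem : IsIdempotentElem (Matrix.toLin' P) := by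
    rw [IsIdempotentElem, Module.End.mul_eq_comp, ← Matrix.toLin'_mul, hP]
  -- The rank of a projection is its trace.
  have hrank : Module.finrank ℝ (LinearMap.range (Matrix.toLin' P)) = r := by
    have h := (LinearMap.IsIdempotentElem.isProj_range _ hidem).trace
    rw [Matrix.trace_toLin'_eq, hr] at h
    exact_mod_cast h.symm
  let W := (LinearMap.range (Matrix.toLin' P)).map
    (WithLp.linearEquiv 2 ℝ (ι → ℝ)).symm.toLinearMap
  have hW : Module.finrank ℝ W = r := (LinearEquiv.finrank_map_eq _ _).trans hrank
  -- The vectors are the columns of P; their Gram matrix is PᵀP = P.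
  have hmem (i : ι) : WithLp.toLp 2 (fun k => P k i) ∈ W :=
    ⟨fun k => P k i, ⟨Pi.single i 1, by ext k; simp⟩, rfl⟩
  let b := (stdOrthonormalBasis ℝ W).reindex (finCongr hW)
  refine ⟨fun i => b.repr ⟨_, hmem i⟩, fun i j => ?_⟩
  rw [LinearIsometryEquiv.inner_map_map, Submodule.coe_inner]
  simp only [PiLp.inner_apply, RCLike.inner_apply, conj_trivial]
  conv_rhs => rw [← hP, Matrix.mul_apply]
  refine Finset.sum_congr rfl fun k _ => ?_
  rw [hs.apply i k, mul_comm]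

open Matrix in
/-- The projection onto the eigenspace of the `G₂(4)` graph for the eigenvalue `20`. -/
noncomputable def g24Proj : Matrix (Fin 416) (Fin 416) ℝ :=
  -- A + 4 kills the eigenvalue -4 and scales the eigenvalue 20 by 24; on constants it is 104 =
  -- 416/4, which the J term cancels.
  (1 / 24 : ℝ) • (g24.adjMatrix ℝ + (4 : ℝ) • 1 - (1 / 4 : ℝ) • of fun _ _ => 1)

theorem g24Proj_apply (i j : Fin 416) :
    g24Proj i j = if i = j then 5 / 32 else if g24.Adj i j then 1 / 32 else -1 / 96 := by
  simp only [g24Proj, Matrix.smul_apply, Matrix.sub_apply, Matrix.add_apply, Matrix.one_apply,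
    SimpleGraph.adjMatrix_apply, Matrix.of_apply, smul_eq_mul]
  by_cases h : i = j
  · subst h
    norm_num
  · by_cases h' : g24.Adj i j <;> norm_num [h, h']

theorem g24Proj_isSymm : g24Proj.IsSymm := by
  ext i j
  rw [Matrix.transpose_apply, g24Proj_apply, g24Proj_apply]
  simp only [eq_comm, g24.adj_comm]

theorem g24Proj_trace : g24Proj.trace = (65 : ℕ) := by
  simp only [Matrix.trace, Matrix.diag_apply, g24Proj_apply]
  norm_num

theorem g24Proj_mul_self : g24Proj * g24Proj = g24Proj := by
  set A := g24.adjMatrix ℝ with hA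
  set J : Matrix (Fin 416) (Fin 416) ℝ := Matrix.of fun _ _ => 1 with hJ
  have hdeg : ∀ v, g24.degree v = 100 := g24_isSRGWith.regular
  have hAJ : A * J = (100 : ℝ) • J := by
    ext i j
    simp [hA, hJ, SimpleGraph.adjMatrix_mul_apply, hdeg]
  have hJA : J * A = (100 : ℝ) • J := by
    ext i j
    simp [hA, hJ, SimpleGraph.mul_adjMatrix_apply, hdeg]
  have hJJ : J * J = (416 : ℝ) • J := by
    ext i j
    simp [hJ, Matrix.mul_apply]
  -- This is 100 I + 36 A + 20 (J - I - A), from counting common neighbours.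
  have hAA : A * A = (80 : ℝ) • 1 + (16 : ℝ) • A + (20 : ℝ) • J := by
    have h := g24_isSRGWith.matrix_eq (α := ℝ)
    rw [pow_two] at h
    rw [hA, h]
    ext i j
    simp only [hJ, Matrix.add_apply, Matrix.smul_apply, Matrix.one_apply, Matrix.of_apply,
      SimpleGraph.adjMatrix_apply, SimpleGraph.compl_adj, smul_eq_mul]
    by_cases hij : i = j
    · subst hij
      norm_num
    · by_cases h' : g24.Adj i j <;> norm_num [hij, h']
  have hdef : g24Proj = (1 / 24 : ℝ) • (A + (4 : ℝ) • 1 - (1 / 4 : ℝ) • J) := rfl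
  rw [hdef]
  simp only [mul_add, add_mul, mul_sub, sub_mul, Matrix.smul_mul, Matrix.mul_smul, hAA, hAJ, hJA,
    hJJ, one_mul, mul_one]
  module

/-! ### Weighted counting and the added simplex -/

/-- If a finite family `f` splits into `k` parts of smaller diameter, then its total weight is at
most `k` times the largest weight of a subfamily with distances smaller than the diameter. -/
theorem SplitsIntoSmaller.sum_le {E ι : Type*} [PseudoMetricSpace E] [Fintype ι] {f : ι → E}
    {k : ℕ} (h : SplitsIntoSmaller (Set.range f) k) {D : ℝ} (hD0 : 0 ≤ D)
    (hD : ∀ i j, dist (f i) (f j) ≤ D) {c : ι → ℕ} {M : ℕ}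
    (hM : ∀ s : Finset ι, (∀ i ∈ s, ∀ j ∈ s, dist (f i) (f j) < D) → ∑ i ∈ s, c i ≤ M) :
    ∑ i, c i ≤ k * M := by
  classical
  obtain ⟨P, -, hU, hdiam⟩ := h
  have hmem (i : ι) : ∃ a, f i ∈ P a := by
    rw [← Set.mem_iUnion, hU]
    exact Set.mem_range_self i
  choose a ha using hmem
  have hle : Metric.diam (Set.range f) ≤ D :=
    Metric.diam_le_of_forall_dist_le hD0 (by rintro _ ⟨i, rfl⟩ _ ⟨j, rfl⟩; exact hD i j)
  rw [← Finset.sum_fiberwise Finset.univ a c]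
  refine (Finset.sum_le_card_nsmul _ _ M fun b _ => hM _ fun i hi j hj => ?_).trans (by simp)
  have hbdd : Bornology.IsBounded (P b) :=
    (Set.finite_range f).isBounded.subset (hU ▸ Set.subset_iUnion P b)
  rw [Finset.mem_filter] at hi hj
  exact (Metric.dist_le_diam_of_mem hbdd (hi.2 ▸ ha i) (hj.2 ▸ ha j)).trans_lt
    ((hdiam b).trans_le hle)

/-- Vectors of prescribed norm at mutual distance `1 / √3` in `ℝᵐ`. -/
theorem exists_simplex {m : ℕ} (hm : 0 < m) : ∃ w : Fin m → Fin m → ℝ,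
    (∀ k, ∑ l, w k l ^ 2 = 17 / 96) ∧ ∀ k k', k ≠ k' → ∑ l, (w k l - w k' l) ^ 2 = 1 / 3 := by
  have hm' : (0 : ℝ) < m := Nat.cast_pos.2 hm
  -- The points are a e_k + t(1, …, 1). Mutual squared distance 2a² = 1/3 fixes a; d = a + mt is the
  -- coordinate sum, chosen to make the squared norm 17/96 = 1/3 - 5/32. By Pythagoras the distance
  -- to the 416 points is then 1/√3.
  set a : ℝ := √(1 / 6) with ha
  have ha2 : a ^ 2 = 1 / 6 := Real.sq_sqrt (by norm_num)
  set d : ℝ := √(1 / 6 + m / 96) with hd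
  have hd2 : d ^ 2 = 1 / 6 + m / 96 := Real.sq_sqrt (by positivity)
  set t : ℝ := (d - a) / m with ht
  have htm : t * m = d - a := div_mul_cancel₀ _ hm'.ne'
  have hquad : a ^ 2 + 2 * a * t + m * t ^ 2 = 17 / 96 := by
    have : m * (a ^ 2 + 2 * a * t + m * t ^ 2) = m * (17 / 96) := by
      linear_combination (2 * a + t * m + d - a) * htm + hd2 + (m - 1) * ha2
    exact mul_left_cancel₀ hm'.ne' this
  refine ⟨fun k l => (if l = k then a else 0) + t, fun k => ?_, fun k k' hk => ?_⟩
  · have h (l : Fin m) : ((if l = k then a else 0) + t) ^ 2 =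
        (if l = k then a ^ 2 + 2 * a * t else 0) + t ^ 2 := by split_ifs <;> ring
    simp only [h, Finset.sum_add_distrib, Finset.sum_ite_eq', Finset.mem_univ, if_true,
      Finset.sum_const, Finset.card_univ, Fintype.card_fin, nsmul_eq_mul]
    exact hquad
  · have h (l : Fin m) : ((if l = k then a else 0) + t - ((if l = k' then a else 0) + t)) ^ 2 =
        (if l = k then a ^ 2 else 0) + (if l = k' then a ^ 2 else 0) := by
      by_cases h1 : l = k
      · simp [h1, hk]
      · by_cases h2 : l = k'
        · subst h2
          simp [h1]
        · simp [h1, h2]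
    simp only [h, Finset.sum_add_distrib, Finset.sum_ite_eq', Finset.mem_univ, if_true, ha2]
    norm_num

theorem g24_card_le_five {s : Finset (Fin 416)}
    (hs : ∀ i ∈ s, ∀ j ∈ s, i ≠ j → g24.Adj i j) : s.card ≤ 5 := by
  by_contra! h
  obtain ⟨t, ht, hcard⟩ := Finset.exists_subset_card_eq (Nat.succ_le_of_lt h)
  exact g24_cliqueFree t ⟨fun i hi j hj => hs i (ht hi) j (ht hj), hcard⟩

/-- A set in dimension `n > 65` that does not split into fewer than `n + 19` parts of smaller
diameter. -/
theorem exists_not_splitsIntoSmaller {n : ℕ} (hn : 65 < n) :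
    ∃ A : Set (EuclideanSpace ℝ (Fin n)), Bornology.IsBounded A ∧ A.Nontrivial ∧
      ∀ k, SplitsIntoSmaller A k → n + 19 ≤ k := by
  obtain ⟨m, rfl⟩ := Nat.exists_eq_add_of_lt hn
  obtain ⟨p, hp⟩ := exists_inner_eq_of_isIdempotentElem g24Proj_isSymm g24Proj_mul_self
    g24Proj_trace
  obtain ⟨w, hw, hww⟩ := exists_simplex m.succ_pos
  let e := LinearIsometryEquiv.piLpCongrLeft 2 ℝ ℝ (finSumFinEquiv (m := 65) (n := m + 1))
  let g : Fin 416 ⊕ Fin (m + 1) → EuclideanSpace ℝ (Fin 65 ⊕ Fin (m + 1)) :=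
    Sum.elim (fun i => WithLp.toLp 2 (Sum.elim (p i) 0)) (fun k => WithLp.toLp 2 (Sum.elim 0 (w k)))
  let f : Fin 416 ⊕ Fin (m + 1) → EuclideanSpace ℝ (Fin (65 + m + 1)) := fun x => e (g x)
  have hdist (x y) : dist (f x) (f y) = √(∑ l, (g x l - g y l) ^ 2) := by
    simp only [f, LinearIsometryEquiv.dist_map, EuclideanSpace.dist_eq, Real.dist_eq, sq_abs]
  have hinner (i j) : ∑ l, p i l * p j l = g24Proj i j := by
    rw [← hp, PiLp.inner_apply]
    simp [mul_comm]
  have hsq (i) : ∑ l, p i l ^ 2 = 5 / 32 := by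
    simp only [pow_two, hinner, g24Proj_apply, if_true]
  have hll (i j) : dist (f (.inl i)) (f (.inl j)) =
      √(if i = j then 0 else if g24.Adj i j then 1 / 4 else 1 / 3) := by
    rw [hdist, Fintype.sum_sum_type]
    have h : ∑ l, (p i l - p j l) ^ 2 = 5 / 32 + 5 / 32 - 2 * g24Proj i j := by
      rw [← hinner, ← hsq i]
      nth_rw 2 [hsq i]
      rw [← hsq j, Finset.mul_sum, ← Finset.sum_add_distrib, ← Finset.sum_sub_distrib]
      exact Finset.sum_congr rfl fun l _ => by ring
    simp only [g, Sum.elim_inl, Sum.elim_inr, h, g24Proj_apply]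
    congr 1
    split_ifs <;> norm_num
  have hlr (i k) : dist (f (.inl i)) (f (.inr k)) = √(1 / 3) := by
    rw [hdist, Fintype.sum_sum_type]
    simp only [g, Sum.elim_inl, Sum.elim_inr, Pi.zero_apply, sub_zero, zero_sub, neg_sq, hsq, hw]
    norm_num
  have hrr (k k') (hk : k ≠ k') : dist (f (.inr k)) (f (.inr k')) = √(1 / 3) := by
    rw [hdist, Fintype.sum_sum_type]
    simp only [g, Sum.elim_inl, Sum.elim_inr, Pi.zero_apply, sub_zero, hww k k' hk]
    norm_num
  have hD (x y) : dist (f x) (f y) ≤ √(1 / 3) := by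
    rcases x with i | k <;> rcases y with j | k'
    · rw [hll]
      refine Real.sqrt_le_sqrt ?_
      split_ifs <;> norm_num
    · exact (hlr _ _).le
    · rw [dist_comm]
      exact (hlr _ _).le
    · by_cases hk : k = k'
      · rw [hk, dist_self]
        positivity
      · exact (hrr _ _ hk).le
  refine ⟨Set.range f, (Set.finite_range f).isBounded,
    ⟨f (.inl 0), ⟨_, rfl⟩, f (.inr 0), ⟨_, rfl⟩, fun h => ?_⟩, fun k hk => ?_⟩
  · have h' := hlr 0 0
    rw [h, dist_self] at h'
    exact (Real.sqrt_pos.2 (by norm_num : (0 : ℝ) < 1 / 3)).ne h'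
  -- Weight 5 makes a lone simplex point count as much as a maximum clique. Then 416 + 5(m + 1) ≤
  -- 5k, and integrality gives k ≥ 84 + (m + 1).
  · have key := hk.sum_le (Real.sqrt_nonneg _) hD (c := Sum.elim (fun _ => 1) fun _ => 5) (M := 5)
      fun s hs => ?_
    · simp only [Fintype.sum_sum_type, Sum.elim_inl, Sum.elim_inr, Finset.sum_const,
        Finset.card_univ, Fintype.card_fin, smul_eq_mul] at key
      omega
    · by_cases hr : ∃ k, Sum.inr k ∈ s
      · obtain ⟨k, hk⟩ := hr
        have : s = {Sum.inr k} := by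
          refine Finset.eq_singleton_iff_unique_mem.2 ⟨hk, fun x hx => ?_⟩
          have hlt := hs x hx _ hk
          rcases x with i | k'
          · exact absurd (hlr i k) hlt.ne
          · by_contra hne
            exact hlt.ne (hrr k' k fun h => hne (h ▸ rfl))
        rw [this, Finset.sum_singleton]
        rfl
      · have hsub : s = s.toLeft.map ⟨Sum.inl, Sum.inl_injective⟩ := by
          ext x
          rcases x with i | k
          · simp
          · simpa using fun h => hr ⟨k, h⟩
        rw [hsub, Finset.sum_map]
        simp only [Function.Embedding.coeFn_mk, Sum.elim_inl, Finset.sum_const, smul_eq_mul,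
          mul_one]
        refine g24_card_le_five fun i hi j hj hij => ?_
        by_contra hadj
        have hlt := hs _ (Finset.mem_toLeft.1 hi) _ (Finset.mem_toLeft.1 hj)
        rw [hll, if_neg hij, if_neg hadj] at hlt
        exact hlt.false

/-! ### Finiteness of the Borsuk number and conclusion -/

/-- In every dimension there is a number of parts that suffices for all bounded sets. -/
theorem exists_forall_splitsIntoSmaller (n : ℕ) :
    ∃ k, ∀ A : Set (EuclideanSpace ℝ (Fin n)), Bornology.IsBounded A → A.Nontrivial →
      SplitsIntoSmaller A k := by
  -- A set rescaled to diameter 1 and based at one of its points lies in the unit ball. Two points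
  -- in one ball of radius 1/3 are less than 2/3 apart.
  obtain ⟨t, -, htfin, ht⟩ := finite_cover_balls_of_compact
    (isCompact_closedBall (0 : EuclideanSpace ℝ (Fin n)) 1) (by norm_num : (0 : ℝ) < 1 / 3)
  have := htfin.fintype
  have hcover (x : EuclideanSpace ℝ (Fin n)) :
      ∃ y : t, x ∈ Metric.closedBall 0 1 → dist x y < 1 / 3 := by
    by_cases hx : x ∈ Metric.closedBall (0 : EuclideanSpace ℝ (Fin n)) 1
    · obtain ⟨y, hy, hxy⟩ := Set.mem_iUnion₂.1 (ht hx)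
      exact ⟨⟨y, hy⟩, fun _ => hxy⟩
    · obtain ⟨y, hy, -⟩ := Set.mem_iUnion₂.1 (ht (Metric.mem_closedBall_self zero_le_one))
      exact ⟨⟨y, hy⟩, fun h => absurd h hx⟩
  choose c hc using hcover
  let e := Fintype.equivFin t
  refine ⟨Fintype.card t, fun A hA hA' => ?_⟩
  obtain ⟨a, ha, b, hb, hab⟩ := hA'
  have hpos : 0 < Metric.diam A :=
    (dist_pos.2 hab).trans_le (Metric.dist_le_diam_of_mem hA ha hb)
  set D := Metric.diam A with hD
  have hball {x} (hx : x ∈ A) : D⁻¹ • (x - a) ∈ Metric.closedBall 0 1 := by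
    rw [mem_closedBall_zero_iff, norm_smul, norm_inv, Real.norm_of_nonneg hpos.le,
      ← dist_eq_norm, inv_mul_le_one₀ hpos]
    exact Metric.dist_le_diam_of_mem hA hx ha
  refine ⟨fun i => {x ∈ A | e (c (D⁻¹ • (x - a))) = i}, fun i j hij => ?_, ?_, fun i => ?_⟩
  · exact Set.disjoint_left.2 fun x hx hx' => hij (hx.2.symm.trans hx'.2)
  · ext x
    simp
  · refine (Metric.diam_le_of_forall_dist_le (C := 2 / 3 * D) (by positivity)
      fun x hx y hy => ?_).trans_lt (by linarith)
    have h1 := hc _ (hball hx.1)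
    have h2 := hc _ (hball hy.1)
    rw [← e.injective (hx.2.trans hy.2.symm)] at h2
    have h3 := (dist_triangle_right _ _ _).trans_lt (add_lt_add h1 h2)
    rw [dist_smul₀, dist_sub_right, norm_inv, Real.norm_of_nonneg hpos.le,
      inv_mul_lt_iff₀ hpos] at h3
    linarith

theorem theorem1 :
    333 ≤ borsukNumber 321 ∧ ∀ n : ℕ, 321 ≤ n → n + 1 < borsukNumber n := by
  have key (n : ℕ) (hn : 65 < n) : n + 19 ≤ borsukNumber n := by
    obtain ⟨A, hA, hA', h⟩ := exists_not_splitsIntoSmaller hn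
    -- Nonemptiness matters: `sInf ∅ = 0` would defeat a lower bound.
    exact h _ (Nat.sInf_mem (exists_forall_splitsIntoSmaller n) A hA hA')
  exact ⟨(key 321 (by norm_num)).trans' (by norm_num),
    fun n hn => (key n (by omega)).trans_lt' (by omega)⟩
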